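/- Let $d\ge 1$ and $N\ge 1$. Let $\mathcal U_1,\dots,\mathcal U_N$ be independent Haar-distributed unitaries in $\mathbb U(d)$ (law $\mathrm d\mathcal N$); $\mathcal U_i$ defines the measurement in the orthonormal basis $\{\mathcal U_i|x\rangle\}_{x=1}^d$, with outcome probabilities $p_{\mathcal U_i}(x|\rho)=\mathrm{Tr}(\mathcal U_i|x\rangle\langle x|\mathcal U_i^\dagger\rho)$. The prior is the Haar ensemble of pure states $|\phi\rangle$ of $\mathbb C^d$ (law $\mathrm d\phi$). For outcomes $x_1,\dots,x_k$ of the first $k$ measurements, let $$p(x_1\cdots x_k)=\int \mathrm d\phi\,\prod_{i=1}^k p_{\mathcal U_i}(x_i|\phi),\qquad p(\phi|x_1\cdots x_k)=\frac{\prod_{i=1}^k p_{\mathcal U_i}(x_i|\phi)}{p(x_1\cdots x_k)}$$ be their total probability and the posterior density obtained by Bayesian updating, and let $\hat\rho_B(x_1\cdots x_N)=\int \mathrm d\phi\; p(\phi|x_1\cdots x_N)\,|\phi\rangle\langle\phi|$ be the Bayesian mean estimator. With the fidelity $F(\rho,\sigma)=(\mathrm{Tr}\sqrt{\sqrt\rho\,\sigma\sqrt\rho})^2$,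 the risk at a pure state $\psi$, given the outcomes $x_1,\dots,x_{N-1}$ before the last one, is $$R_{\mathcal N}(\psi;x_1\cdots x_{N-1})=\sum_{x=1}^d p_{\mathcal U_N}(x|\psi)\,\bigl(1-F(|\psi\rangle\langle\psi|,\hat\rho_B(x_1\cdots x_{N-1}x))\bigr).$$ Let $f(d,N)=\dfrac{(d+3)\,(N+d-1)!}{d^N (d+1)^2\, N!\,(d-1)!}$. Then the Haar-averaged risk is at most $1-f(d,N)$, in each of the following senses (all integrands being integrable): (1) for every pure state $\psi$ and all outcomes $x_1,\dots,x_{N-1}$, $\displaystyle\int \mathrm d\mathcal N\, R_{\mathcal N}(\psi;x_1\cdots x_{N-1})\le 1-f(d,N)$; (2) for every pure state $\psi$, with the earlier outcomes sampled from their total distribution, $\displaystyle\int \mathrm d\mathcal N\sum_{x_1,\dots,x_{N-1}} p(x_1\cdots x_{N-1})\,R_{\mathcal N}(\psi;x_1\cdots x_{N-1})\le 1-f(d,N)$; (3) with the earlier outcomes sampled from their total distribution and the risk averaged over the ensemble with respect to the posterior, $\displaystyle\int \mathrm d\mathcal N\sum_{x_1,\dots,x_{N-1}} p(x_1\cdots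 x_{N-1})\int \mathrm d\psi\; p(\psi|x_1\cdots x_{N-1})\,R_{\mathcal N}(\psi;x_1\cdots x_{N-1})\le 1-f(d,N)$. -/

import Mathlib

open scoped Matrix
open MeasureTheory

namespace HaarBayes

noncomputable section

/-! ### Haar measure on the unitary group and on pure states -/

/-- The unitary group `𝕌(d)`. -/
abbrev UnitaryMat (d : ℕ) : Type := Matrix.unitaryGroup (Fin d) ℂ

instance (d : ℕ) : MeasurableSpace (UnitaryMat d) := borel _

instance (d : ℕ) : BorelSpace (UnitaryMat d) := ⟨rfl⟩

instance (d : ℕ) : CompactSpace (UnitaryMat d) := by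
  have hK : IsCompact (Set.pi Set.univ fun _ : Fin d => Set.pi Set.univ fun _ : Fin d =>
      Metric.closedBall (0 : ℂ) 1) :=
    isCompact_univ_pi fun _ => isCompact_univ_pi fun _ => isCompact_closedBall _ _
  suffices h : IsCompact ((Matrix.unitaryGroup (Fin d) ℂ :
      Submonoid (Matrix (Fin d) (Fin d) ℂ)) : Set (Matrix (Fin d) (Fin d) ℂ)) from
    isCompact_iff_compactSpace.mp h
  refine IsCompact.of_isClosed_subset (X := Matrix (Fin d) (Fin d) ℂ) hK ?_ ?_
  · have h : ((Matrix.unitaryGroup (Fin d) ℂ : Submonoid (Matrix (Fin d) (Fin d) ℂ)) :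
        Set (Matrix (Fin d) (Fin d) ℂ)) = {A | star A * A = 1} := by
      ext A
      exact Matrix.mem_unitaryGroup_iff'
    rw [h]
    exact isClosed_eq (continuous_star.mul continuous_id) continuous_const
  · intro A hA i _ j _
    simpa using entry_norm_bound_of_unitary hA i j

instance (d : ℕ) : SecondCountableTopology (UnitaryMat d) := by
  have : SecondCountableTopology (Matrix (Fin d) (Fin d) ℂ) :=
    inferInstanceAs (SecondCountableTopology (Fin d → Fin d → ℂ))
  exact TopologicalSpace.Subtype.secondCountableTopology _

/-- The Haar probability measure on `𝕌(d)`. -/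
def haarUnitary (d : ℕ) : Measure (UnitaryMat d) :=
  Measure.haarMeasure (⊤ : TopologicalSpace.PositiveCompacts (UnitaryMat d))

instance (d : ℕ) : IsProbabilityMeasure (haarUnitary d) :=
  ⟨Measure.haarMeasure_self (K₀ := (⊤ : TopologicalSpace.PositiveCompacts (UnitaryMat d)))⟩

/-- The set of pure states (unit vectors) of `ℂ^d`. -/
abbrev PureState (d : ℕ) : Type := Metric.sphere (0 : EuclideanSpace ℂ (Fin d)) 1

/-- The first column of a unitary matrix, a unit vector of `ℂ^d`. -/
def firstColumn (d : ℕ) [NeZero d] (U : UnitaryMat d) : PureState d :=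
  ⟨WithLp.toLp 2 fun i => (U : Matrix (Fin d) (Fin d) ℂ) i 0, by
    have h := congrFun (congrFun (Matrix.mem_unitaryGroup_iff'.mp U.2) 0) 0
    have h2 : ∑ i, ‖(U : Matrix (Fin d) (Fin d) ℂ) i 0‖ ^ 2 = 1 := by
      have h3 : ((∑ i, ‖(U : Matrix (Fin d) (Fin d) ℂ) i 0‖ ^ 2 : ℝ) : ℂ) = 1 := by
        rw [Matrix.one_apply_eq] at h
        rw [← h, Matrix.mul_apply]
        push_cast
        refine Finset.sum_congr rfl fun i _ => ?_
        rw [Matrix.star_apply, ← Complex.conj_mul']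
        rfl
      exact_mod_cast h3
    rw [mem_sphere_zero_iff_norm, EuclideanSpace.norm_eq]
    simp [h2]⟩

lemma continuous_firstColumn (d : ℕ) [NeZero d] : Continuous (firstColumn d) := by
  refine Continuous.subtype_mk ?_ _
  refine (PiLp.continuous_toLp 2 _).comp (continuous_pi fun i => ?_)
  exact (continuous_apply (0 : Fin d)).comp ((continuous_apply i).comp continuous_subtype_val)

/-- The Haar ensemble of pure states: the law of a fixed column of a Haar-random unitary. -/
def haarPure (d : ℕ) [NeZero d] : Measure (PureState d) :=
  (haarUnitary d).map (firstColumn d)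

instance (d : ℕ) [NeZero d] : IsProbabilityMeasure (haarPure d) :=
  Measure.isProbabilityMeasure_map (continuous_firstColumn d).measurable.aemeasurable

/-- The density matrix `|ψ⟩⟨ψ|`. -/
def density {d : ℕ} (ψ : PureState d) : Matrix (Fin d) (Fin d) ℂ :=
  Matrix.vecMulVec (fun i => ψ.1 i) (fun i => star (ψ.1 i))

/-! ### Measurements, Bayes rule, risk -/

/-- Born's rule `p_U(x|ρ) = Tr(U|x⟩⟨x|U† ρ)` for the measurement in the basis of columns of `U`. -/
def bornProb {d : ℕ} (U : UnitaryMat d) (x : Fin d) (ρ : Matrix (Fin d) (Fin d) ℂ) : ℝ :=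
  (Matrix.trace ((U : Matrix (Fin d) (Fin d) ℂ) * Matrix.single x x 1 *
    (U : Matrix (Fin d) (Fin d) ℂ)ᴴ * ρ)).re

/-- The probability of the outcomes `x₁ ⋯ x_k` in the bases `U₁, …, U_k` given the state `φ`. -/
def likelihood {d k : ℕ} (U : Fin k → UnitaryMat d) (x : Fin k → Fin d) (φ : PureState d) : ℝ :=
  ∏ i, bornProb (U i) (x i) (density φ)

/-- The total probability of the outcomes `x₁ ⋯ x_k` in the bases `U₁, …, U_k`, for a state drawn
from the Haar ensemble; it is the normalization constant of Bayes' rule. -/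
def totalProb {d k : ℕ} [NeZero d] (U : Fin k → UnitaryMat d) (x : Fin k → Fin d) : ℝ :=
  ∫ φ, likelihood U x φ ∂haarPure d

/-- The density, with respect to the Haar prior, of the posterior given `x₁ ⋯ x_k`. -/
def posterior {d k : ℕ} [NeZero d] (U : Fin k → UnitaryMat d) (x : Fin k → Fin d)
    (φ : PureState d) : ℝ :=
  likelihood U x φ / totalProb U x

/-- The Bayes estimator: the mean of the states `|φ⟩⟨φ|` under the posterior. -/
def bayesEstimator {d k : ℕ} [NeZero d] (U : Fin k → UnitaryMat d) (x : Fin k → Fin d) :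
    Matrix (Fin d) (Fin d) ℂ :=
  Matrix.of fun i j => ∫ φ, (posterior U x φ : ℂ) * density φ i j ∂haarPure d

open scoped MatrixOrder in
/-- The (squared, Uhlmann) fidelity `F(ρ, σ) = (Tr √(√ρ σ √ρ))²`. -/
def fidelity {d : ℕ} (ρ σ : Matrix (Fin d) (Fin d) ℂ) : ℝ :=
  (Matrix.trace (CFC.sqrt (CFC.sqrt ρ * σ * CFC.sqrt ρ))).re ^ 2

/-- The infidelity. -/
def infidelity {d : ℕ} (ρ σ : Matrix (Fin d) (Fin d) ℂ) : ℝ := 1 - fidelity ρ σ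

/-- The risk of the Bayes estimator at the state `ψ` for a sequence of `N = n + 1` measurement
bases, given the outcomes `x₁ ⋯ x_n` of all measurements but the last one: the expected infidelity
over the outcome `y` of the last measurement performed on `ψ`. -/
def risk {d n : ℕ} [NeZero d] (U : Fin (n + 1) → UnitaryMat d) (x : Fin n → Fin d)
    (ψ : PureState d) : ℝ :=
  ∑ y : Fin d, bornProb (U (Fin.last n)) y (density ψ) *
    infidelity (density ψ) (bayesEstimator U (Fin.snoc x y : Fin (n + 1) → Fin d))

/-- The risk at `ψ` when the outcomes before the last one are sampled from their total
probability distribution. -/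
def sampledRisk {d n : ℕ} [NeZero d] (U : Fin (n + 1) → UnitaryMat d) (ψ : PureState d) : ℝ :=
  ∑ x : Fin n → Fin d, totalProb (Fin.init U : Fin n → UnitaryMat d) x * risk U x ψ

/-- The average risk: the outcomes before the last one are sampled from their total probability
distribution, and the risk is averaged over the ensemble with respect to the posterior. -/
def averageRisk {d n : ℕ} [NeZero d] (U : Fin (n + 1) → UnitaryMat d) : ℝ :=
  ∑ x : Fin n → Fin d, totalProb (Fin.init U : Fin n → UnitaryMat d) x *
    ∫ ψ, posterior (Fin.init U : Fin n → UnitaryMat d) x ψ * risk U x ψ ∂haarPure d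

/-- The law of a sequence of `N` IID Haar-random measurement bases. -/
def haarSequence (d N : ℕ) : Measure (Fin N → UnitaryMat d) :=
  Measure.pi fun _ => haarUnitary d

/-- `f(d, N) = (d + 3) (N + d - 1)! / (d^N (d + 1)² N! (d - 1)!)`, for `d ≥ 1`. -/
def f (d N : ℕ) : ℝ :=
  ((d : ℝ) + 3) * (N + d - 1).factorial /
    ((d : ℝ) ^ N * ((d : ℝ) + 1) ^ 2 * N.factorial * (d - 1).factorial)

end

end HaarBayes

/-! The fidelity with a pure state is linear in the estimator: `fidelity (density ψ) σ` is ⟨ψ|σ|ψ⟩.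
At the Bayes estimator it is therefore a quotient, the integral of likelihood times `overlap ψ φ`
divided by the total probability. The denominator is the only obstacle to averaging over the bases.
By AM-GM it is at most `maxTotalProb`, the N-th moment of an overlap (`totalProb_le`). Replacing it
by this worst value bounds the risk by an expression linear in the likelihood (`risk_le`).

The linear expression can be averaged exactly, because the bases are independent. With q the overlap
of ψ and φ, an earlier outcome contributes the first moment 1/d, and the last measurement, summed
over its outcomes, contributes (1 + q)/(d + 1). The integral of q(1 + q)/(d + 1) over φ is (d +
3)/(d(d + 1)²), which gives f for fixed earlier outcomes.

When the earlier outcomes are sampled, each earlier basis contributes (1 + q')/(d + 1), with q' the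
overlap of φ with the state that produced the outcomes. Bernoulli's inequality bounds the n-th power
of this below by (1/d)ⁿ plus a multiple of dq' - 1, which has mean zero. If that state is
independent of ψ, the linear term integrates to zero. If it is ψ itself, the linear term is
nonnegatively correlated with q(1 + q), so it can only help.

The overlap moments come from left invariance of Haar measure alone, through polarization and
comparison of polynomial coefficients. -/

namespace HaarBayes

/-! ### Overlaps and columns -/

/-- The overlap `|⟨φ|ψ⟩|²` of two pure states. -/
noncomputable def overlap {d : ℕ} (φ ψ : PureState d) : ℝ := ‖inner ℂ φ.1 ψ.1‖ ^ 2

lemma norm_pureState {d : ℕ} (φ : PureState d) : ‖φ.1‖ = 1 := mem_sphere_zero_iff_norm.mp φ.2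

lemma overlap_nonneg {d : ℕ} (φ ψ : PureState d) : 0 ≤ overlap φ ψ := sq_nonneg _

lemma overlap_le_one {d : ℕ} (φ ψ : PureState d) : overlap φ ψ ≤ 1 := by
  have h := norm_inner_le_norm (𝕜 := ℂ) φ.1 ψ.1
  rw [norm_pureState, norm_pureState, one_mul] at h
  exact pow_le_one₀ (norm_nonneg _) h

lemma overlap_comm {d : ℕ} (φ ψ : PureState d) : overlap φ ψ = overlap ψ φ := by
  rw [overlap, overlap, norm_inner_symm]

@[fun_prop]
lemma continuous_overlap {d : ℕ} {T : Type*} [TopologicalSpace T] {f g : T → PureState d}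
    (hf : Continuous f) (hg : Continuous g) : Continuous fun t => overlap (f t) (g t) := by
  unfold overlap
  fun_prop

/-- The columns of a unitary matrix, as pure states. -/
def column {d : ℕ} (y : Fin d) (U : UnitaryMat d) : PureState d :=
  ⟨WithLp.toLp 2 fun i => (U : Matrix (Fin d) (Fin d) ℂ) i y, by
    have h := congrFun (congrFun (Matrix.mem_unitaryGroup_iff'.mp U.2) y) y
    have h2 : ∑ i, ‖(U : Matrix (Fin d) (Fin d) ℂ) i y‖ ^ 2 = 1 := by
      have h3 : ((∑ i, ‖(U : Matrix (Fin d) (Fin d) ℂ) i y‖ ^ 2 : ℝ) : ℂ) = 1 := by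
        rw [Matrix.one_apply_eq] at h
        rw [← h, Matrix.mul_apply]
        push_cast
        refine Finset.sum_congr rfl fun i _ => ?_
        rw [Matrix.star_apply, ← Complex.conj_mul']
        rfl
      exact_mod_cast h3
    rw [mem_sphere_zero_iff_norm, EuclideanSpace.norm_eq]
    simp [h2]⟩

@[fun_prop]
lemma continuous_column {d : ℕ} (y : Fin d) : Continuous (column y) := by
  refine Continuous.subtype_mk ?_ _
  refine (PiLp.continuous_toLp 2 _).comp (continuous_pi fun i => ?_)
  exact (continuous_apply y).comp ((continuous_apply i).comp continuous_subtype_val)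

lemma inner_column {d : ℕ} (x y : Fin d) (V U : UnitaryMat d) :
    inner ℂ (column x V).1 (column y U).1 = ((V⁻¹ * U : UnitaryMat d) : Matrix _ _ ℂ) x y := by
  rw [PiLp.inner_apply]
  change _ = (star (V : Matrix (Fin d) (Fin d) ℂ) * (U : Matrix (Fin d) (Fin d) ℂ) :
    Matrix (Fin d) (Fin d) ℂ) x y
  rw [Matrix.mul_apply]
  refine Finset.sum_congr rfl fun i _ => ?_
  simp [column, Matrix.star_apply, mul_comm]

/-- A unit vector extends to an orthonormal basis. Overlaps thus become entries of unitary matrices,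
on which left translation acts. -/
lemma exists_column_eq {d : ℕ} (x : Fin d) (v : PureState d) : ∃ V, column x V = v := by
  have hv : Orthonormal ℂ (({x} : Set (Fin d)).domRestrict fun _ => v.1) := by
    refine ⟨fun _ => norm_pureState v, fun i j hij => ?_⟩
    exact absurd (Subsingleton.elim i j) hij
  obtain ⟨b, hb⟩ := Orthonormal.exists_orthonormalBasis_extension_of_card_eq
    (𝕜 := ℂ) (E := EuclideanSpace ℂ (Fin d)) (ι := Fin d) (by simp) hv
  refine ⟨⟨_, OrthonormalBasis.toMatrix_orthonormalBasis_mem_unitary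
    (EuclideanSpace.basisFun (Fin d) ℂ) b⟩, ?_⟩
  apply Subtype.ext
  ext i
  simp [column, Module.Basis.toMatrix_apply, hb x rfl]

lemma overlap_column_column {d : ℕ} (x y : Fin d) (V U : UnitaryMat d) :
    overlap (column x V) (column y U) = overlap (column x 1) (column y (V⁻¹ * U)) := by
  rw [overlap, overlap, inner_column, inner_column]
  simp

lemma sum_overlap_column {d : ℕ} (U : UnitaryMat d) (φ : PureState d) :
    ∑ y, overlap (column y U) φ = 1 := by
  rcases d with _ | d
  · have := norm_pureState φ
    rw [Subsingleton.elim φ.1 0] at this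
    simp at this
  obtain ⟨W, rfl⟩ := exists_column_eq 0 φ
  -- The overlaps are the squared moduli of the entries of a column of this unitary, so they sum to
  -- 1.
  set X : UnitaryMat (d + 1) := U⁻¹ * W
  have h := norm_pureState (column 0 X)
  rw [EuclideanSpace.norm_eq, Real.sqrt_eq_one] at h
  rw [← h]
  refine Finset.sum_congr rfl fun y _ => ?_
  rw [overlap, inner_column]
  rfl

/-! ### Isotropic measures on pure states and their moments -/

/-- A measure on pure states is isotropic if the moments of the overlap with a fixed state do not
depend on this state. -/
def IsIsotropic {d : ℕ} (μ : Measure (PureState d)) : Prop :=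
  ∀ (v w : PureState d) (N : ℕ), ∫ φ, overlap v φ ^ N ∂μ = ∫ φ, overlap w φ ^ N ∂μ

instance isMulLeftInvariant_haarUnitary (d : ℕ) : (haarUnitary d).IsMulLeftInvariant := by
  unfold haarUnitary; infer_instance

instance isProbabilityMeasure_map_column {d : ℕ} (y : Fin d) :
    IsProbabilityMeasure ((haarUnitary d).map (column y)) :=
  Measure.isProbabilityMeasure_map (continuous_column y).measurable.aemeasurable

lemma integral_map_column {d : ℕ} (y : Fin d) {g : PureState d → ℝ} (hg : Continuous g) :
    ∫ φ, g φ ∂(haarUnitary d).map (column y) = ∫ U, g (column y U) ∂haarUnitary d :=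
  integral_map (continuous_column y).measurable.aemeasurable hg.aestronglyMeasurable

lemma isIsotropic_map_column {d : ℕ} (y : Fin d) :
    IsIsotropic ((haarUnitary d).map (column y)) := by
  have key : ∀ (v : PureState d) (N : ℕ), ∫ φ, overlap v φ ^ N ∂(haarUnitary d).map (column y) =
      ∫ U, overlap (column y 1) (column y U) ^ N ∂haarUnitary d := by
    intro v N
    obtain ⟨V, rfl⟩ := exists_column_eq y v
    rw [integral_map_column y (by fun_prop)]
    simp_rw [overlap_column_column y y V]
    exact integral_mul_left_eq_self
      (fun U => overlap (column y 1) (column y U) ^ N) V⁻¹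
  intro v w N
  rw [key, key]

lemma isIsotropic_haarPure (d : ℕ) [NeZero d] : IsIsotropic (haarPure d) :=
  isIsotropic_map_column 0

lemma integrable_of_continuous {T : Type*} [TopologicalSpace T] [CompactSpace T]
    [MeasurableSpace T] [OpensMeasurableSpace T] {μ : Measure T} [IsFiniteMeasure μ]
    {g : T → ℝ} (hg : Continuous g) : Integrable g μ :=
  hg.integrable_of_hasCompactSupport (HasCompactSupport.of_compactSpace g)

section Moments

variable {d : ℕ} {μ : Measure (PureState d)} [IsProbabilityMeasure μ]

/-- Homogeneity extends isotropy to vectors of any length, which is what polarization with u + tw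
requires. -/
lemma IsIsotropic.integral_norm_inner_pow (hμ : IsIsotropic μ) (v : EuclideanSpace ℂ (Fin d))
    (w : PureState d) (N : ℕ) :
    ∫ φ : PureState d, (‖inner ℂ v φ.1‖ ^ 2) ^ N ∂μ =
      (‖v‖ ^ 2) ^ N * ∫ φ, overlap w φ ^ N ∂μ := by
  by_cases hv : v = 0
  · subst hv
    rcases N with _ | N <;> simp
  have hv' : ‖v‖ ≠ 0 := norm_ne_zero_iff.mpr hv
  let u : PureState d := ⟨((‖v‖⁻¹ : ℝ) : ℂ) • v, by
    rw [mem_sphere_zero_iff_norm, norm_smul]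
    simp [hv']⟩
  rw [hμ w u, ← integral_const_mul]
  refine integral_congr_ae (ae_of_all _ fun φ => ?_)
  simp only [overlap, u, inner_smul_left, norm_mul, ← mul_pow]
  congr 1
  simp only [RCLike.norm_conj, Complex.norm_real, norm_inv, norm_norm]
  field_simp

/-- Polarization: the fourth powers |⟨u + ωw, φ⟩|⁴ are summed over the fourth roots of unity ω, once
pointwise and once through the norms of u + ωw. -/
lemma IsIsotropic.integral_overlap_mul_overlap_of_moment_two (hμ : IsIsotropic μ)
    (u w : PureState d) :
    ∫ φ, overlap u φ * overlap w φ ∂μ =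
      (1 + overlap u w) / 2 * ∫ φ, overlap u φ ^ 2 ∂μ := by
  have h := fun v : EuclideanSpace ℂ (Fin d) => hμ.integral_norm_inner_pow v u 2
  have h1 := h (u.1 + w.1)
  have h2 := h (u.1 - w.1)
  have h3 := h (u.1 + Complex.I • w.1)
  have h4 := h (u.1 - Complex.I • w.1)
  have h5 := hμ w u 2
  set m := ∫ φ, overlap u φ ^ 2 ∂μ
  have key : ∀ a b : ℂ, (‖a + b‖ ^ 2) ^ 2 + (‖a - b‖ ^ 2) ^ 2 + (‖a - Complex.I * b‖ ^ 2) ^ 2 +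
      (‖a + Complex.I * b‖ ^ 2) ^ 2 =
      4 * (‖a‖ ^ 2) ^ 2 + 4 * (‖b‖ ^ 2) ^ 2 + 16 * (‖a‖ ^ 2 * ‖b‖ ^ 2) := by
    intro a b
    simp only [← Complex.normSq_eq_norm_sq, Complex.normSq_apply, Complex.add_re, Complex.add_im,
      Complex.sub_re, Complex.sub_im, Complex.mul_re, Complex.mul_im, Complex.I_re, Complex.I_im]
    ring
  have hL : ∫ φ : PureState d, ((‖inner ℂ (u.1 + w.1) φ.1‖ ^ 2) ^ 2 +
      (‖inner ℂ (u.1 - w.1) φ.1‖ ^ 2) ^ 2 + (‖inner ℂ (u.1 + Complex.I • w.1) φ.1‖ ^ 2) ^ 2 +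
      (‖inner ℂ (u.1 - Complex.I • w.1) φ.1‖ ^ 2) ^ 2) ∂μ =
      ∫ φ : PureState d, (4 * overlap u φ ^ 2 + 4 * overlap w φ ^ 2 +
        16 * (overlap u φ * overlap w φ)) ∂μ := by
    refine integral_congr_ae (ae_of_all _ fun φ => ?_)
    simp only [overlap]
    rw [← key]
    simp only [inner_add_left, inner_sub_left, inner_smul_left, Complex.conj_I, neg_mul,
      sub_neg_eq_add, ← sub_eq_add_neg]
  rw [integral_add, integral_add, integral_add, h1, h2, h3, h4, integral_add, integral_add,
    integral_const_mul, integral_const_mul, integral_const_mul, h5] at hL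
  rotate_left
  all_goals try exact integrable_of_continuous (by fun_prop)
  have hn1 : ∀ x y : EuclideanSpace ℂ (Fin d), ‖x + y‖ ^ 2 =
      ‖x‖ ^ 2 + 2 * (inner ℂ x y : ℂ).re + ‖y‖ ^ 2 := fun x y => norm_add_sq (𝕜 := ℂ) x y
  have hn2 : ∀ x y : EuclideanSpace ℂ (Fin d), ‖x - y‖ ^ 2 =
      ‖x‖ ^ 2 - 2 * (inner ℂ x y : ℂ).re + ‖y‖ ^ 2 := fun x y => norm_sub_sq (𝕜 := ℂ) x y
  simp only [hn1, hn2, norm_smul, Complex.norm_I, norm_pureState, inner_smul_right,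
    Complex.mul_re, Complex.I_re, Complex.I_im] at hL
  have ho : overlap u w = (inner ℂ u.1 w.1 : ℂ).re ^ 2 + (inner ℂ u.1 w.1 : ℂ).im ^ 2 := by
    rw [overlap, ← Complex.normSq_eq_norm_sq, Complex.normSq_apply]; ring
  rw [ho]
  linarith

end Moments

/-! ### Overlap moments of every order -/

section Moments

open Polynomial in
lemma coeff_quadratic_pow (a b c : ℝ) (N : ℕ) :
    ((C a + C b * X + C c * X ^ 2 : ℝ[X]) ^ N).coeff 0 = a ^ N ∧
    ((C a + C b * X + C c * X ^ 2 : ℝ[X]) ^ N).coeff 1 = N * a ^ (N - 1) * b ∧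
    ((C a + C b * X + C c * X ^ 2 : ℝ[X]) ^ N).coeff 2 =
      N * a ^ (N - 1) * c + N * (N - 1) / 2 * a ^ (N - 2) * b ^ 2 := by
  have hq : (C a + C b * X + C c * X ^ 2 : ℝ[X]).coeff 0 = a ∧
      (C a + C b * X + C c * X ^ 2 : ℝ[X]).coeff 1 = b ∧
      (C a + C b * X + C c * X ^ 2 : ℝ[X]).coeff 2 = c := by
    refine ⟨?_, ?_, ?_⟩ <;> simp [coeff_X, coeff_C]
  obtain ⟨q0, q1, q2⟩ := hq
  have hmul : ∀ p q : ℝ[X], (p * q).coeff 2 =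
      p.coeff 0 * q.coeff 2 + p.coeff 1 * q.coeff 1 + p.coeff 2 * q.coeff 0 := by
    intro p q
    rw [coeff_mul]
    simp [Finset.Nat.antidiagonal_succ]
    ring
  generalize (C a + C b * X + C c * X ^ 2 : ℝ[X]) = q at *
  induction N with
  | zero => simp [coeff_one]
  | succ N ih =>
    obtain ⟨h0, h1, h2⟩ := ih
    rw [pow_succ q N, mul_coeff_zero, mul_coeff_one, hmul, h0, h1, h2, q0, q1, q2]
    -- The exponents N - 1 and N - 2 are truncated, so the smallest cases are separate; there the
    -- prefactors vanish whenever truncation occurs.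
    rcases N with _ | _ | N
    · simp
    · refine ⟨by ring, by simp; ring, by simp; ring⟩
    · simp only [Nat.add_sub_cancel, show N + 1 + 1 + 1 - 2 = N + 1 by omega,
        show N + 1 + 1 - 2 = N by omega]
      push_cast
      refine ⟨?_, ?_, ?_⟩ <;> ring

open Polynomial in
lemma continuous_coeff_pow {T : Type*} [TopologicalSpace T] {p : T → ℝ[X]}
    (hp : ∀ k, Continuous fun t => (p t).coeff k) (N k : ℕ) :
    Continuous fun t => (p t ^ N).coeff k := by
  induction N generalizing k with
  | zero => simpa using continuous_const
  | succ N ih =>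
    simp only [pow_succ, coeff_mul]
    exact continuous_finsetSum _ fun i _ => (ih i.1).mul (hp i.2)

variable {d : ℕ} {μ : Measure (PureState d)} [IsProbabilityMeasure μ]

-- For w orthogonal to u, the integral of |⟨u + tw, φ⟩|²ᴺ is (1 + t²)ᴺ times the N-th moment. Both
-- sides are polynomials in t, and the identity compares the coefficients of t².
open Polynomial in
lemma IsIsotropic.integral_coeff_two (hμ : IsIsotropic μ) (u : PureState d)
    (w : EuclideanSpace ℂ (Fin d)) (hw : ‖w‖ = 1) (huw : (inner ℂ u.1 w : ℂ) = 0) (N : ℕ) :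
    ∫ φ, (N * overlap u φ ^ (N - 1) * ‖inner ℂ w φ.1‖ ^ 2 + N * (N - 1) / 2 *
      overlap u φ ^ (N - 2) * (2 * (inner ℂ u.1 φ.1 * star (inner ℂ w φ.1) : ℂ).re) ^ 2) ∂μ =
      N * ∫ φ, overlap u φ ^ N ∂μ := by
  set m := ∫ φ, overlap u φ ^ N ∂μ
  let p : PureState d → ℝ[X] := fun φ => C (overlap u φ) +
    C (2 * (inner ℂ u.1 φ.1 * star (inner ℂ w φ.1) : ℂ).re) * X +
      C (‖inner ℂ w φ.1‖ ^ 2) * X ^ 2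
  have hp : ∀ k, Continuous fun φ => (p φ).coeff k := by
    intro k
    simp only [p, coeff_add, coeff_C_mul, coeff_C]
    refine Continuous.add (Continuous.add ?_ ?_) ?_
    · split_ifs
      · fun_prop
      · fun_prop
    · refine Continuous.mul ?_ continuous_const
      fun_prop
    · fun_prop
  have hdeg : ∀ φ, (p φ ^ N).natDegree < N * 2 + 1 := by
    intro φ
    refine Nat.lt_succ_of_le (natDegree_pow_le_of_le N ?_)
    simp only [p]
    compute_degree
  have heval : ∀ (φ : PureState d) (t : ℝ), (p φ ^ N).eval t =
      (‖inner ℂ (u.1 + (t : ℂ) • w) φ.1‖ ^ 2) ^ N := by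
    intro φ t
    rw [eval_pow]
    congr 1
    simp only [p, overlap, inner_add_left, inner_smul_left, eval_add, eval_mul, eval_C, eval_X,
      eval_pow]
    simp only [← Complex.normSq_eq_norm_sq, Complex.normSq_apply, Complex.add_re, Complex.add_im,
      Complex.mul_re, Complex.mul_im, Complex.star_def, Complex.conj_re, Complex.conj_im,
      Complex.ofReal_re, Complex.ofReal_im]
    ring
  have hnorm : ∀ t : ℝ, ‖u.1 + (t : ℂ) • w‖ ^ 2 = 1 + t ^ 2 := by
    intro t
    rw [norm_add_sq (𝕜 := ℂ), inner_smul_right, huw, norm_smul, hw, norm_pureState]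
    simp
  have hpoly : (∑ k ∈ Finset.range (N * 2 + 1), C (∫ φ, (p φ ^ N).coeff k ∂μ) * X ^ k : ℝ[X]) =
      (C 1 + C 0 * X + C 1 * X ^ 2) ^ N * C m := by
    refine Polynomial.funext fun t => ?_
    have h := hμ.integral_norm_inner_pow (u.1 + (t : ℂ) • w) u N
    simp_rw [← heval, hnorm] at h
    simp_rw [fun φ => eval_eq_sum_range' (hdeg φ) t] at h
    rw [integral_finsetSum] at h
    · simp only [eval_finsetSum, eval_mul, eval_C, eval_pow, eval_X, eval_add, zero_mul, add_zero,
        one_mul]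
      rw [← h]
      exact Finset.sum_congr rfl fun k _ => (integral_mul_const _ _).symm
    · intro k _
      exact integrable_of_continuous ((continuous_coeff_pow hp N k).mul continuous_const)
  have h2 := congrArg (fun q => coeff q 2) hpoly
  simp only [finsetSum_coeff, coeff_C_mul, coeff_X_pow, mul_ite, mul_one, mul_zero, coeff_mul_C,
    Finset.sum_ite_eq, (coeff_quadratic_pow _ _ _ N).2.2] at h2
  -- The exponent 2 lies below 2N + 1 only for N ≥ 1; for N = 0 both sides vanish.
  rcases N with _ | N
  · simp
  rw [if_pos (by simp)] at h2
  simp only [p, (coeff_quadratic_pow _ _ _ (N + 1)).2.2] at h2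
  rw [h2]
  simp

/-- Adding the t² identities for w and iw turns the squared real parts into a squared modulus,
leaving only products of overlaps. -/
lemma IsIsotropic.integral_pow_mul_overlap (hμ : IsIsotropic μ) (u w : PureState d)
    (huw : (inner ℂ u.1 w.1 : ℂ) = 0) (N : ℕ) :
    (N + 1) * ∫ φ, overlap u φ ^ N * overlap w φ ∂μ = ∫ φ, overlap u φ ^ (N + 1) ∂μ := by
  have h1 := hμ.integral_coeff_two u w.1 (norm_pureState w) huw (N + 1)
  have h2 := hμ.integral_coeff_two u (Complex.I • w.1) (by simp [norm_smul])
    (by rw [inner_smul_right, huw, mul_zero]) (N + 1)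
  have h3 := congrArg₂ (· + ·) h1 h2
  beta_reduce at h3
  rw [← integral_add (integrable_of_continuous (by fun_prop))
    (integrable_of_continuous (by fun_prop))] at h3
  have h4 : ∀ φ : PureState d, ((N + 1 : ℕ) * overlap u φ ^ (N + 1 - 1) * ‖inner ℂ w.1 φ.1‖ ^ 2 +
      (N + 1 : ℕ) * ((N + 1 : ℕ) - 1) / 2 * overlap u φ ^ (N + 1 - 2) *
        (2 * (inner ℂ u.1 φ.1 * star (inner ℂ w.1 φ.1) : ℂ).re) ^ 2) +
      ((N + 1 : ℕ) * overlap u φ ^ (N + 1 - 1) * ‖inner ℂ (Complex.I • w.1) φ.1‖ ^ 2 +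
      (N + 1 : ℕ) * ((N + 1 : ℕ) - 1) / 2 * overlap u φ ^ (N + 1 - 2) *
        (2 * (inner ℂ u.1 φ.1 * star (inner ℂ (Complex.I • w.1) φ.1) : ℂ).re) ^ 2) =
      2 * (N + 1) ^ 2 * (overlap u φ ^ N * overlap w φ) := by
    intro φ
    have hB : (2 * (inner ℂ u.1 φ.1 * star (inner ℂ w.1 φ.1) : ℂ).re) ^ 2 +
        (2 * (inner ℂ u.1 φ.1 * star (inner ℂ (Complex.I • w.1) φ.1) : ℂ).re) ^ 2 =
        4 * (overlap u φ * overlap w φ) := by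
      simp only [overlap, inner_smul_left]
      simp only [← Complex.normSq_eq_norm_sq, Complex.normSq_apply, Complex.mul_re,
        Complex.mul_im, Complex.star_def, Complex.conj_re, Complex.conj_im, Complex.I_re,
        Complex.I_im]
      ring
    have hC : ‖inner ℂ (Complex.I • w.1) φ.1‖ ^ 2 = overlap w φ := by
      simp [overlap]
    have hD : ‖inner ℂ w.1 φ.1‖ ^ 2 = overlap w φ := rfl
    rw [hC, hD]
    rcases N with _ | N
    · simp; ring
    · simp only [Nat.add_sub_cancel, show N + 1 + 1 - 2 = N by omega]
      push_cast
      linear_combination ((N : ℝ) + 1 + 1) * (N + 1 + 1 - 1) / 2 * overlap u φ ^ N * hB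
  simp_rw [h4] at h3
  rw [integral_const_mul] at h3
  have hN : (N : ℝ) + 1 ≠ 0 := by positivity
  push_cast at h3
  apply mul_left_cancel₀ hN
  linarith

lemma inner_column_eq_zero {x y : Fin d} (h : x ≠ y) (U : UnitaryMat d) :
    (inner ℂ (column x U).1 (column y U).1 : ℂ) = 0 := by
  rw [inner_column]
  simp [h]

/-- The overlaps with a basis containing u sum to 1. Multiplied by the N-th power of the overlap
with u, each of the d - 1 orthogonal directions contributes 1/(N + 1) of the next moment, and u
contributes all of it. -/
lemma IsIsotropic.integral_overlap_pow_succ (hμ : IsIsotropic μ) (u : PureState d) (N : ℕ) :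
    (N + 1 : ℝ) * ∫ φ, overlap u φ ^ N ∂μ = (N + d : ℝ) * ∫ φ, overlap u φ ^ (N + 1) ∂μ := by
  rcases d with _ | d
  · have := sum_overlap_column 1 u
    simp at this
  obtain ⟨V, rfl⟩ := exists_column_eq 0 u
  have h : ∫ φ, overlap (column 0 V) φ ^ N ∂μ =
      ∑ y, ∫ φ, overlap (column 0 V) φ ^ N * overlap (column y V) φ ∂μ := by
    rw [← integral_finsetSum]
    · refine integral_congr_ae (ae_of_all _ fun φ => ?_)
      simp only
      rw [← Finset.mul_sum, sum_overlap_column, mul_one]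
    · exact fun y _ => integrable_of_continuous (by fun_prop)
  rw [h, Finset.mul_sum, Fin.sum_univ_succ]
  have h2 : ∀ y : Fin d, (N + 1) * ∫ φ, overlap (column 0 V) φ ^ N *
      overlap (column y.succ V) φ ∂μ = ∫ φ, overlap (column 0 V) φ ^ (N + 1) ∂μ := fun y =>
    hμ.integral_pow_mul_overlap _ _ (inner_column_eq_zero (Fin.succ_ne_zero y).symm V) N
  simp_rw [h2, ← pow_succ]
  simp
  ring

lemma IsIsotropic.integral_overlap (hμ : IsIsotropic μ) (u : PureState d) :
    ∫ φ, overlap u φ ∂μ = 1 / d := by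
  have h := hμ.integral_overlap_pow_succ u 0
  have hd : (d : ℝ) ≠ 0 := by
    rintro h0
    simp [h0] at h
  simp at h
  field_simp
  linarith

lemma IsIsotropic.integral_overlap_sq (hμ : IsIsotropic μ) (u : PureState d) :
    ∫ φ, overlap u φ ^ 2 ∂μ = 2 / (d * (d + 1)) := by
  have h := hμ.integral_overlap_pow_succ u 1
  simp only [pow_one, hμ.integral_overlap] at h
  have hd : (d : ℝ) + 1 ≠ 0 := by positivity
  have h' : ∫ φ, overlap u φ ^ 2 ∂μ = 2 * (1 / d) / (d + 1) := by
    rw [eq_div_iff hd]; push_cast at h; linarith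
  rw [h', mul_one_div, div_div]

lemma IsIsotropic.integral_overlap_mul_overlap (hμ : IsIsotropic μ) (u w : PureState d) :
    ∫ φ, overlap u φ * overlap w φ ∂μ = (1 + overlap u w) / (d * (d + 1)) := by
  rw [hμ.integral_overlap_mul_overlap_of_moment_two, hμ.integral_overlap_sq]
  ring

lemma IsIsotropic.integral_overlap_pow (hμ : IsIsotropic μ) (u : PureState d) (N : ℕ) :
    ∫ φ, overlap u φ ^ N ∂μ = N.factorial * (d - 1).factorial / (N + d - 1).factorial := by
  rcases d with _ | d
  · have := sum_overlap_column 1 u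
    simp at this
  induction N with
  | zero => simp [Nat.factorial_ne_zero]
  | succ N ih =>
    have h := hμ.integral_overlap_pow_succ u N
    rw [ih] at h
    have e1 : N + (d + 1) - 1 = N + d := by omega
    have e2 : N + 1 + (d + 1) - 1 = N + d + 1 := by omega
    rw [e1] at h
    rw [e2, Nat.factorial_succ, Nat.factorial_succ (N + d)]
    have hne : (N : ℝ) + (d + 1) ≠ 0 := by positivity
    have hf : ((N + d).factorial : ℝ) ≠ 0 := by positivity
    push_cast at h ⊢
    rw [eq_div_iff (by positivity)]
    field_simp at h
    linarith

end Moments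

section

/-! ### Born probabilities, likelihoods and fidelities as overlaps -/

variable {d : ℕ}

lemma bornProb_density (U : UnitaryMat d) (y : Fin d) (φ : PureState d) :
    bornProb U y (density φ) = overlap (column y U) φ := by
  have h : (U : Matrix (Fin d) (Fin d) ℂ) * Matrix.single y y 1 * (U : Matrix _ _ ℂ)ᴴ =
      Matrix.vecMulVec (fun i => (U : Matrix (Fin d) (Fin d) ℂ) i y)
        (fun i => star ((U : Matrix (Fin d) (Fin d) ℂ) i y)) := by
    ext i j
    simp [Matrix.mul_apply, Matrix.vecMulVec_apply, Matrix.single_apply, ite_and,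
      Finset.sum_ite_eq]
  have hi : ((fun i => star ((U : Matrix (Fin d) (Fin d) ℂ) i y)) ⬝ᵥ fun i => φ.1 i) =
      inner ℂ (column y U).1 φ.1 := by
    rw [PiLp.inner_apply]
    simp [dotProduct, column, mul_comm]
  have hi2 : ((fun i => (U : Matrix (Fin d) (Fin d) ℂ) i y) ⬝ᵥ fun i => star (φ.1 i)) =
      star (inner ℂ (column y U).1 φ.1) := by
    rw [← hi]
    simp [dotProduct, mul_comm]
  rw [bornProb, h, density, Matrix.vecMulVec_mul_vecMulVec, Matrix.trace_vecMulVec,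
    dotProduct_smul, hi, hi2, overlap, ← Complex.normSq_eq_norm_sq, smul_eq_mul,
    Complex.star_def, Complex.mul_conj, Complex.ofReal_re]

lemma likelihood_eq_prod {k : ℕ} (U : Fin k → UnitaryMat d) (x : Fin k → Fin d)
    (φ : PureState d) : likelihood U x φ = ∏ i, overlap (column (x i) (U i)) φ := by
  simp only [likelihood, bornProb_density]

@[fun_prop]
lemma continuous_likelihood {k : ℕ} {T : Type*} [TopologicalSpace T]
    {U : T → Fin k → UnitaryMat d} {φ : T → PureState d} (hU : Continuous U) (hφ : Continuous φ)
    (x : Fin k → Fin d) : Continuous fun t => likelihood (U t) x (φ t) := by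
  simp only [likelihood_eq_prod]
  fun_prop

lemma likelihood_nonneg {k : ℕ} (U : Fin k → UnitaryMat d) (x : Fin k → Fin d)
    (φ : PureState d) : 0 ≤ likelihood U x φ := by
  rw [likelihood_eq_prod]
  exact Finset.prod_nonneg fun i _ => overlap_nonneg _ _

lemma sum_likelihood {k : ℕ} (U : Fin k → UnitaryMat d) (φ : PureState d) :
    ∑ x, likelihood U x φ = 1 := by
  simp only [likelihood_eq_prod]
  have h := Finset.prod_univ_sum (fun _ : Fin k => (Finset.univ : Finset (Fin d)))
    fun i y => overlap (column y (U i)) φ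
  rw [Fintype.piFinset_univ] at h
  rw [← h]
  simp [sum_overlap_column]

lemma likelihood_snoc {n : ℕ} (U : Fin (n + 1) → UnitaryMat d) (x : Fin n → Fin d) (y : Fin d)
    (φ : PureState d) : likelihood U (Fin.snoc x y : Fin (n + 1) → Fin d) φ =
      likelihood (Fin.init U : Fin n → UnitaryMat d) x φ *
        overlap (column y (U (Fin.last n))) φ := by
  rw [likelihood_eq_prod, likelihood_eq_prod, Fin.prod_univ_castSucc]
  simp [Fin.init]

open scoped ComplexOrder in
lemma posSemidef_density (ψ : PureState d) : (density ψ).PosSemidef :=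
  Matrix.posSemidef_vecMulVec_self_star _

lemma star_dotProduct_eq_inner (ψ φ : PureState d) :
    ((fun i => star (ψ.1 i)) ⬝ᵥ fun i => φ.1 i) = inner ℂ ψ.1 φ.1 := by
  rw [PiLp.inner_apply]
  simp [dotProduct, mul_comm]

lemma density_mul_mul_density (ψ : PureState d) (σ : Matrix (Fin d) (Fin d) ℂ) :
    density ψ * σ * density ψ =
      ((fun i => star (ψ.1 i)) ⬝ᵥ (σ *ᵥ fun i => ψ.1 i)) • density ψ := by
  rw [density, Matrix.vecMulVec_mul, Matrix.vecMulVec_mul_vecMulVec, Matrix.dotProduct_mulVec,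
    Matrix.vecMulVec_smul]

lemma density_mul_self (ψ : PureState d) : density ψ * density ψ = density ψ := by
  have h := density_mul_mul_density ψ 1
  rw [mul_one, Matrix.one_mulVec, star_dotProduct_eq_inner, inner_self_eq_norm_sq_to_K,
    norm_pureState] at h
  simpa using h

lemma trace_density (ψ : PureState d) : (density ψ).trace = 1 := by
  rw [density, Matrix.trace_vecMulVec, dotProduct_comm, star_dotProduct_eq_inner,
    inner_self_eq_norm_sq_to_K, norm_pureState]
  simp

-- The projection |ψ⟩⟨ψ| is its own square root, and compressing σ by it gives c|ψ⟩⟨ψ|, whose square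
-- root has trace √c.
open scoped MatrixOrder ComplexOrder in
lemma fidelity_density_of_eq {ψ : PureState d} {σ : Matrix (Fin d) (Fin d) ℂ} {c : ℝ} (hc : 0 ≤ c)
    (h : ((fun i => star (ψ.1 i)) ⬝ᵥ (σ *ᵥ fun i => ψ.1 i)) = (c : ℂ)) :
    fidelity (density ψ) σ = c := by
  have hP : 0 ≤ density ψ := Matrix.nonneg_iff_posSemidef.mpr (posSemidef_density ψ)
  have h1 : CFC.sqrt (density ψ) = density ψ := CFC.sqrt_unique (density_mul_self ψ) hP
  have h2 : CFC.sqrt ((c : ℂ) • density ψ) = ((√c : ℝ) : ℂ) • density ψ := by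
    refine CFC.sqrt_unique ?_ ?_
    · rw [smul_mul_smul_comm, density_mul_self, ← Complex.ofReal_mul, Real.mul_self_sqrt hc]
    · rw [Matrix.nonneg_iff_posSemidef]
      exact (posSemidef_density ψ).smul (Complex.zero_le_real.mpr (Real.sqrt_nonneg c))
  rw [fidelity, h1, density_mul_mul_density, h, h2, Matrix.trace_smul, trace_density]
  simp [Real.sq_sqrt hc]

variable [NeZero d]

lemma totalProb_nonneg {k : ℕ} (U : Fin k → UnitaryMat d) (x : Fin k → Fin d) :
    0 ≤ totalProb U x := integral_nonneg fun _ => likelihood_nonneg _ _ _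

lemma sum_totalProb {k : ℕ} (U : Fin k → UnitaryMat d) : ∑ x, totalProb U x = 1 := by
  simp only [totalProb]
  rw [← integral_finsetSum _ fun x _ => integrable_of_continuous (by fun_prop)]
  simp [sum_likelihood]

lemma posterior_nonneg {k : ℕ} (U : Fin k → UnitaryMat d) (x : Fin k → Fin d)
    (φ : PureState d) : 0 ≤ posterior U x φ :=
  div_nonneg (likelihood_nonneg _ _ _) (totalProb_nonneg _ _)

@[fun_prop]
lemma continuous_posterior {k : ℕ} (U : Fin k → UnitaryMat d) (x : Fin k → Fin d) :
    Continuous (posterior U x) := by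
  unfold posterior
  fun_prop

lemma fidelity_bayesEstimator {k : ℕ} (U : Fin k → UnitaryMat d) (x : Fin k → Fin d)
    (ψ : PureState d) : fidelity (density ψ) (bayesEstimator U x) =
      ∫ φ, posterior U x φ * overlap ψ φ ∂haarPure d := by
  refine fidelity_density_of_eq
    (integral_nonneg fun φ => mul_nonneg (posterior_nonneg _ _ _) (overlap_nonneg _ _)) ?_
  rw [← integral_complex_ofReal]
  have hint : ∀ g : PureState d → ℂ, Continuous g → Integrable g (haarPure d) := fun g hg =>
    hg.integrable_of_hasCompactSupport (HasCompactSupport.of_compactSpace g)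
  have ho : ∀ φ : PureState d, ((posterior U x φ * overlap ψ φ : ℝ) : ℂ) =
      ∑ i, ∑ j, star (ψ.1 i) * (posterior U x φ * (φ.1 i * star (φ.1 j)) * ψ.1 j) := by
    intro φ
    have h : (overlap ψ φ : ℂ) = inner ℂ ψ.1 φ.1 * inner ℂ φ.1 ψ.1 := by
      rw [overlap, ← inner_conj_symm φ.1 ψ.1, Complex.mul_conj, Complex.normSq_eq_norm_sq]
    simp only [Complex.ofReal_mul, h, ← star_dotProduct_eq_inner, dotProduct, Finset.mul_sum,
      Finset.sum_mul]
    rw [Finset.sum_comm]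
    refine Finset.sum_congr rfl fun i _ => Finset.sum_congr rfl fun j _ => ?_
    ring
  simp_rw [ho]
  rw [integral_finsetSum _ fun i _ => hint _ (by fun_prop)]
  refine Finset.sum_congr rfl fun i _ => ?_
  rw [integral_finsetSum _ fun j _ => hint _ (by fun_prop), Matrix.mulVec, dotProduct,
    Finset.mul_sum]
  refine Finset.sum_congr rfl fun j _ => ?_
  rw [integral_const_mul, integral_mul_const]
  rfl

end

section

variable {d : ℕ}

/-! ### Integrals over the measurement bases -/

instance (d N : ℕ) : IsProbabilityMeasure (haarSequence d N) := by
  unfold haarSequence; infer_instance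

/-- The probability that the measurement in the basis `W` has the same outcome on two states. -/
noncomputable def coincidence (W : UnitaryMat d) (φ ψ : PureState d) : ℝ :=
  ∑ y, overlap (column y W) φ * overlap (column y W) ψ

@[fun_prop]
lemma continuous_coincidence {T : Type*} [TopologicalSpace T] {W : T → UnitaryMat d}
    {φ ψ : T → PureState d} (hW : Continuous W) (hφ : Continuous φ) (hψ : Continuous ψ) :
    Continuous fun t => coincidence (W t) (φ t) (ψ t) := by
  unfold coincidence
  fun_prop

lemma integral_overlap_column (y : Fin d) (φ : PureState d) :
    ∫ W, overlap (column y W) φ ∂haarUnitary d = 1 / d := by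
  rw [← (isIsotropic_map_column y).integral_overlap φ, integral_map_column y (by fun_prop)]
  simp_rw [overlap_comm φ]

lemma integral_coincidence [NeZero d] (φ ψ : PureState d) :
    ∫ W, coincidence W φ ψ ∂haarUnitary d = (1 + overlap φ ψ) / (d + 1) := by
  have hd : (d : ℝ) ≠ 0 := NeZero.ne _
  simp only [coincidence]
  rw [integral_finsetSum _ fun y _ => integrable_of_continuous (by fun_prop)]
  have h : ∀ y : Fin d, ∫ W, overlap (column y W) φ * overlap (column y W) ψ ∂haarUnitary d =
      (1 + overlap φ ψ) / (d * (d + 1)) := by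
    intro y
    rw [← (isIsotropic_map_column y).integral_overlap_mul_overlap,
      integral_map_column y (by fun_prop)]
    simp_rw [overlap_comm φ, overlap_comm ψ]
  simp only [h, Finset.sum_const, Finset.card_univ, Fintype.card_fin, nsmul_eq_mul]
  field_simp

/-- Independence of the bases, with the last one singled out because it enters the risk differently.
-/
lemma integral_prod_init_mul_last {n : ℕ} (g : Fin n → UnitaryMat d → ℝ) (h : UnitaryMat d → ℝ) :
    ∫ U, (∏ i, g i ((Fin.init U : Fin n → UnitaryMat d) i)) * h (U (Fin.last n))
      ∂haarSequence d (n + 1) =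
      (∏ i, ∫ W, g i W ∂haarUnitary d) * ∫ W, h W ∂haarUnitary d := by
  have := integral_fintype_prod_eq_prod (𝕜 := ℝ)
    (Fin.snoc (α := fun _ : Fin (n + 1) => UnitaryMat d → ℝ) g h) (μ := fun _ => haarUnitary d)
  simpa [Fin.prod_univ_castSucc, haarSequence, Fin.init] using this

lemma sum_likelihood_mul_likelihood {k : ℕ} (U : Fin k → UnitaryMat d) (φ ψ : PureState d) :
    ∑ x, likelihood U x φ * likelihood U x ψ = ∏ i, coincidence (U i) φ ψ := by
  simp only [likelihood_eq_prod, ← Finset.prod_mul_distrib, coincidence]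
  rw [Finset.prod_univ_sum, Fintype.piFinset_univ]

@[fun_prop]
lemma continuous_init {n : ℕ} : Continuous fun U : Fin (n + 1) → UnitaryMat d =>
    (Fin.init U : Fin n → UnitaryMat d) :=
  continuous_pi fun i => continuous_apply i.castSucc

/-! ### Bounds on the total probability and on the fidelity -/

lemma prod_le_sum_pow_div_card {k : ℕ} (a : Fin (k + 1) → ℝ) (ha : ∀ i, 0 ≤ a i) :
    ∏ i, a i ≤ ∑ i, (k + 1 : ℝ)⁻¹ * a i ^ (k + 1) := by
  have h := Real.geom_mean_le_arith_mean_weighted Finset.univ (fun _ => (k + 1 : ℝ)⁻¹)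
    (fun i => a i ^ (k + 1)) (fun i _ => by positivity) (by simp; field_simp)
    (fun i _ => pow_nonneg (ha i) _)
  refine le_trans (le_of_eq ?_) h
  refine Finset.prod_congr rfl fun i _ => ?_
  have := Real.pow_rpow_inv_natCast (ha i) (Nat.succ_ne_zero k)
  push_cast at this
  exact this.symm

/-- The largest total probability of `N` outcomes, the inverse of the dimension of the symmetric
power `Sym^N ℂ^d`. -/
noncomputable def maxTotalProb (d N : ℕ) : ℝ :=
  N.factorial * (d - 1).factorial / (N + d - 1).factorial

lemma maxTotalProb_pos (d N : ℕ) : 0 < maxTotalProb d N := by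
  unfold maxTotalProb
  positivity

variable [NeZero d]

/-- AM-GM replaces a product of overlaps with different states by a mean of powers of single
overlaps, and all of these have the same moment. -/
lemma totalProb_le {k : ℕ} (U : Fin (k + 1) → UnitaryMat d) (x : Fin (k + 1) → Fin d) :
    totalProb U x ≤ maxTotalProb d (k + 1) := by
  have h : totalProb U x ≤
      ∫ φ, ∑ i, (k + 1 : ℝ)⁻¹ * overlap (column (x i) (U i)) φ ^ (k + 1) ∂haarPure d := by
    refine integral_mono (integrable_of_continuous (by fun_prop))
      (integrable_of_continuous (by fun_prop)) fun φ => ?_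
    rw [likelihood_eq_prod]
    exact prod_le_sum_pow_div_card _ fun i => overlap_nonneg _ _
  refine h.trans (le_of_eq ?_)
  rw [integral_finsetSum _ fun y _ => integrable_of_continuous (by fun_prop)]
  simp_rw [integral_const_mul, (isIsotropic_haarPure d).integral_overlap_pow]
  simp only [Finset.sum_const, Finset.card_univ, Fintype.card_fin, nsmul_eq_mul, maxTotalProb]
  push_cast
  rw [← mul_assoc, mul_inv_cancel₀ (by positivity), one_mul]

lemma fidelity_bayesEstimator_eq_div {k : ℕ} (U : Fin k → UnitaryMat d) (x : Fin k → Fin d)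
    (ψ : PureState d) : fidelity (density ψ) (bayesEstimator U x) =
      (∫ φ, likelihood U x φ * overlap ψ φ ∂haarPure d) / totalProb U x := by
  rw [fidelity_bayesEstimator, ← integral_div]
  refine integral_congr_ae (ae_of_all _ fun φ => ?_)
  simp only [posterior]
  ring

lemma integral_likelihood_mul_overlap_nonneg {k : ℕ} (U : Fin k → UnitaryMat d)
    (x : Fin k → Fin d) (ψ : PureState d) :
    0 ≤ ∫ φ, likelihood U x φ * overlap ψ φ ∂haarPure d :=
  integral_nonneg fun _ => mul_nonneg (likelihood_nonneg _ _ _) (overlap_nonneg _ _)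

lemma integral_likelihood_mul_overlap_le {k : ℕ} (U : Fin k → UnitaryMat d)
    (x : Fin k → Fin d) (ψ : PureState d) :
    ∫ φ, likelihood U x φ * overlap ψ φ ∂haarPure d ≤ totalProb U x :=
  integral_mono (integrable_of_continuous (by fun_prop)) (integrable_of_continuous (by fun_prop))
    fun _ => mul_le_of_le_one_right (likelihood_nonneg _ _ _) (overlap_le_one _ _)

lemma fidelity_bayesEstimator_nonneg {k : ℕ} (U : Fin k → UnitaryMat d) (x : Fin k → Fin d)
    (ψ : PureState d) : 0 ≤ fidelity (density ψ) (bayesEstimator U x) := by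
  rw [fidelity_bayesEstimator_eq_div]
  exact div_nonneg (integral_likelihood_mul_overlap_nonneg _ _ _) (totalProb_nonneg _ _)

lemma fidelity_bayesEstimator_le_one {k : ℕ} (U : Fin k → UnitaryMat d) (x : Fin k → Fin d)
    (ψ : PureState d) : fidelity (density ψ) (bayesEstimator U x) ≤ 1 := by
  rw [fidelity_bayesEstimator_eq_div]
  exact div_le_one_of_le₀ (integral_likelihood_mul_overlap_le _ _ _) (totalProb_nonneg _ _)

lemma le_fidelity_bayesEstimator {k : ℕ} (U : Fin (k + 1) → UnitaryMat d)
    (x : Fin (k + 1) → Fin d) (ψ : PureState d) :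
    (maxTotalProb d (k + 1))⁻¹ * ∫ φ, likelihood U x φ * overlap ψ φ ∂haarPure d ≤
      fidelity (density ψ) (bayesEstimator U x) := by
  rw [fidelity_bayesEstimator_eq_div, inv_mul_eq_div]
  have h0 := integral_likelihood_mul_overlap_nonneg U x ψ
  have h1 := integral_likelihood_mul_overlap_le U x ψ
  -- At total probability zero the quotient is 0 by convention, and the numerator vanishes as well.
  rcases (totalProb_nonneg U x).eq_or_lt with hp | hp
  · rw [← hp] at h1
    rw [le_antisymm h1 h0]
    simp
  · exact div_le_div_of_nonneg_left h0 hp (totalProb_le U x)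

/-! ### Bounds on the risk -/

/-- The part of the mean fidelity at `ψ` not due to the normalization of the posterior. -/
noncomputable def unnormalizedFidelity {n : ℕ} (U : Fin (n + 1) → UnitaryMat d) (x : Fin n → Fin d)
    (ψ : PureState d) : ℝ :=
  ∫ φ, likelihood (Fin.init U : Fin n → UnitaryMat d) x φ *
    (overlap ψ φ * coincidence (U (Fin.last n)) ψ φ) ∂haarPure d

lemma continuous_integral_haarPure {X : Type*} [TopologicalSpace X] [FirstCountableTopology X]
    [LocallyCompactSpace X] {g : X → PureState d → ℝ} (hg : Continuous (Function.uncurry g)) :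
    Continuous fun t => ∫ φ, g t φ ∂haarPure d := by
  simpa using continuous_parametric_integral_of_continuous (μ := haarPure d) hg isCompact_univ

lemma risk_le {n : ℕ} (U : Fin (n + 1) → UnitaryMat d) (x : Fin n → Fin d) (ψ : PureState d) :
    risk U x ψ ≤ 1 - (maxTotalProb d (n + 1))⁻¹ * unnormalizedFidelity U x ψ := by
  have h : unnormalizedFidelity U x ψ = ∑ y, overlap (column y (U (Fin.last n))) ψ *
      ∫ φ, likelihood U (Fin.snoc x y : Fin (n + 1) → Fin d) φ * overlap ψ φ ∂haarPure d := by
    simp_rw [← integral_const_mul]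
    rw [← integral_finsetSum _ fun y _ => integrable_of_continuous (by fun_prop)]
    refine integral_congr_ae (ae_of_all _ fun φ => ?_)
    simp only [likelihood_snoc, coincidence, Finset.mul_sum]
    exact Finset.sum_congr rfl fun y _ => by ring
  have h1 := sum_overlap_column (U (Fin.last n)) ψ
  rw [h]
  -- The constant 1 is written as the sum of the last outcome's probabilities, so that the
  -- comparison is made outcome by outcome.
  refine le_of_le_of_eq ?_ (congrArg (fun t : ℝ => t - _) h1)
  rw [Finset.mul_sum, ← Finset.sum_sub_distrib]
  refine Finset.sum_le_sum fun y _ => ?_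
  rw [bornProb_density, infidelity]
  have h2 := mul_le_mul_of_nonneg_left
    (le_fidelity_bayesEstimator U (Fin.snoc x y : Fin (n + 1) → Fin d) ψ)
    (overlap_nonneg (column y (U (Fin.last n))) ψ)
  linarith

lemma risk_nonneg {n : ℕ} (U : Fin (n + 1) → UnitaryMat d) (x : Fin n → Fin d)
    (ψ : PureState d) : 0 ≤ risk U x ψ := by
  refine Finset.sum_nonneg fun y _ => ?_
  rw [bornProb_density]
  exact mul_nonneg (overlap_nonneg _ _) (sub_nonneg.mpr (fidelity_bayesEstimator_le_one _ _ _))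

lemma risk_le_one {n : ℕ} (U : Fin (n + 1) → UnitaryMat d) (x : Fin n → Fin d)
    (ψ : PureState d) : risk U x ψ ≤ 1 := by
  rw [← sum_overlap_column (U (Fin.last n)) ψ]
  refine Finset.sum_le_sum fun y _ => ?_
  rw [bornProb_density]
  exact mul_le_of_le_one_right (overlap_nonneg _ _)
    (sub_le_self _ (fidelity_bayesEstimator_nonneg _ _ _))

lemma continuous_totalProb {k : ℕ} (x : Fin k → Fin d) :
    Continuous fun U : Fin k → UnitaryMat d => totalProb U x := by
  unfold totalProb
  refine continuous_integral_haarPure ?_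
  unfold Function.uncurry
  fun_prop

/-- The total probability may vanish, so continuity of the quotient is not available; measurability
is enough, as the risk lies in [0, 1]. -/
lemma measurable_risk {n : ℕ} (x : Fin n → Fin d) :
    Measurable fun t : (Fin (n + 1) → UnitaryMat d) × PureState d => risk t.1 x t.2 := by
  simp only [risk, bornProb_density, infidelity, fidelity_bayesEstimator_eq_div]
  refine Finset.measurable_sum _ fun y _ => ?_
  refine Measurable.mul (Continuous.measurable (by fun_prop))
    (measurable_const.sub (Measurable.div ?_ ?_))
  · refine Continuous.measurable (continuous_integral_haarPure ?_)
    unfold Function.uncurry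
    fun_prop
  · exact ((continuous_totalProb _).comp continuous_fst).measurable

lemma integrable_likelihood_mul_risk {n : ℕ} (U : Fin (n + 1) → UnitaryMat d) (x : Fin n → Fin d) :
    Integrable (fun ψ => likelihood (Fin.init U : Fin n → UnitaryMat d) x ψ * risk U x ψ)
      (haarPure d) := by
  refine Integrable.mono (g := fun ψ => likelihood (Fin.init U : Fin n → UnitaryMat d) x ψ)
    (integrable_of_continuous (by fun_prop)) ?_ (ae_of_all _ fun ψ => ?_)
  · have h1 : Measurable fun ψ => risk U x ψ := 
      Measurable.of_uncurry_left (f := fun U ψ => risk U x ψ) (measurable_risk x)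
    have h2 : Measurable fun ψ => likelihood (Fin.init U : Fin n → UnitaryMat d) x ψ :=
      Continuous.measurable (by fun_prop)
    exact (h2.mul h1).aestronglyMeasurable
  · rw [norm_mul, Real.norm_of_nonneg (risk_nonneg _ _ _)]
    exact mul_le_of_le_one_right (norm_nonneg _) (risk_le_one _ _ _)

lemma integral_likelihood_mul_risk_le_totalProb {n : ℕ} (U : Fin (n + 1) → UnitaryMat d)
    (x : Fin n → Fin d) :
    ∫ ψ, likelihood (Fin.init U : Fin n → UnitaryMat d) x ψ * risk U x ψ ∂haarPure d ≤
      totalProb (Fin.init U : Fin n → UnitaryMat d) x :=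
  integral_mono (integrable_likelihood_mul_risk U x) (integrable_of_continuous (by fun_prop))
    fun ψ => mul_le_of_le_one_right (likelihood_nonneg _ _ _) (risk_le_one _ _ _)

lemma integral_likelihood_mul_risk_nonneg {n : ℕ} (U : Fin (n + 1) → UnitaryMat d)
    (x : Fin n → Fin d) :
    0 ≤ ∫ ψ, likelihood (Fin.init U : Fin n → UnitaryMat d) x ψ * risk U x ψ ∂haarPure d :=
  integral_nonneg fun _ => mul_nonneg (likelihood_nonneg _ _ _) (risk_nonneg _ _ _)

/-- The posterior's normalization cancels the outcome weight. Where the weight is zero, the integral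
on the right is squeezed between 0 and that weight. -/
lemma averageRisk_eq {n : ℕ} (U : Fin (n + 1) → UnitaryMat d) :
    averageRisk U = ∑ x : Fin n → Fin d,
      ∫ ψ, likelihood (Fin.init U : Fin n → UnitaryMat d) x ψ * risk U x ψ ∂haarPure d := by
  refine Finset.sum_congr rfl fun x _ => ?_
  have h0 := integral_likelihood_mul_risk_nonneg U x
  have h1 := integral_likelihood_mul_risk_le_totalProb U x
  by_cases hp : totalProb (Fin.init U : Fin n → UnitaryMat d) x = 0
  · rw [hp] at h1 ⊢
    rw [le_antisymm h1 h0, zero_mul]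
  · rw [← integral_const_mul]
    refine integral_congr_ae (ae_of_all _ fun ψ => ?_)
    simp only [posterior]
    field_simp

end

variable {d : ℕ} [NeZero d]

/-! ### Averaging over the measurement bases -/

lemma integral_haarSequence_swap {n : ℕ} {g : (Fin n → UnitaryMat d) → PureState d → ℝ}
    (hg : Continuous (Function.uncurry g)) :
    ∫ U, ∫ φ, g U φ ∂haarPure d ∂haarSequence d n = ∫ φ, ∫ U, g U φ ∂haarSequence d n ∂haarPure d :=
  integral_integral_swap (integrable_of_continuous hg)

lemma integral_overlap_haarPure (ψ : PureState d) :
    ∫ φ, overlap ψ φ ∂haarPure d = 1 / d :=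
  (isIsotropic_haarPure d).integral_overlap ψ

lemma integral_overlap_mul_one_add (ψ : PureState d) :
    ∫ φ, overlap ψ φ * ((1 + overlap ψ φ) / (d + 1)) ∂haarPure d =
      (d + 3) / (d * (d + 1) ^ 2) := by
  have hd : (d : ℝ) ≠ 0 := NeZero.ne _
  have h : ∀ φ, overlap ψ φ * ((1 + overlap ψ φ) / (d + 1)) =
      (d + 1 : ℝ)⁻¹ * (overlap ψ φ + overlap ψ φ ^ 2) := fun φ => by ring
  simp_rw [h]
  rw [integral_const_mul, integral_add (integrable_of_continuous (by fun_prop))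
    (integrable_of_continuous (by fun_prop)), integral_overlap_haarPure,
    (isIsotropic_haarPure d).integral_overlap_sq]
  field_simp
  ring

/-- The expansion is around q = 1/d, the mean overlap, where (1 + q)/(d + 1) equals 1/d. -/
lemma bernoulli_overlap (n : ℕ) {q : ℝ} (hq : 0 ≤ q) :
    (1 / d : ℝ) ^ n * (1 + n * ((d * q - 1) / (d + 1))) ≤ ((1 + q) / (d + 1)) ^ n := by
  have hd : (0 : ℝ) < d := Nat.cast_pos.mpr (NeZero.pos d)
  have h1 : (1 + q) / (d + 1) = 1 / d * (1 + (d * q - 1) / (d + 1)) := by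
    field_simp
    ring
  rw [h1, mul_pow]
  refine mul_le_mul_of_nonneg_left (one_add_mul_le_pow ?_ n) (by positivity)
  rw [le_div_iff₀ (by positivity)]
  nlinarith [mul_nonneg hd.le hq]

lemma integral_bernoulli_overlap (ψ : PureState d) (a b : ℝ) :
    ∫ φ, (a + b * ((d * overlap ψ φ - 1) / (d + 1))) ∂haarPure d = a := by
  have hd : (d : ℝ) ≠ 0 := NeZero.ne _
  rw [integral_add (integrable_of_continuous (by fun_prop))
    (integrable_of_continuous (by fun_prop)), integral_const_mul, integral_div,
    integral_sub (integrable_of_continuous (by fun_prop))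
    (integrable_of_continuous (by fun_prop)), integral_const_mul, integral_overlap_haarPure]
  simp [hd]

lemma integral_likelihood_mul_coincidence {n : ℕ} (x : Fin n → Fin d) (φ ψ : PureState d) :
    ∫ U, likelihood (Fin.init U : Fin n → UnitaryMat d) x φ *
      (overlap ψ φ * coincidence (U (Fin.last n)) ψ φ) ∂haarSequence d (n + 1) =
      (1 / d : ℝ) ^ n * (overlap ψ φ * ((1 + overlap ψ φ) / (d + 1))) := by
  simp_rw [likelihood_eq_prod]
  rw [integral_prod_init_mul_last (fun i W => overlap (column (x i) W) φ)
    (fun W => overlap ψ φ * coincidence W ψ φ)]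
  simp [integral_overlap_column, integral_const_mul, integral_coincidence]

lemma integral_prod_coincidence (n : ℕ) (φ' φ ψ : PureState d) :
    ∫ U, (∏ i, coincidence ((Fin.init U : Fin n → UnitaryMat d) i) φ' φ) *
      (overlap ψ φ * coincidence (U (Fin.last n)) ψ φ) ∂haarSequence d (n + 1) =
      ((1 + overlap φ' φ) / (d + 1)) ^ n *
        (overlap ψ φ * ((1 + overlap ψ φ) / (d + 1))) := by
  rw [integral_prod_init_mul_last (fun _ W => coincidence W φ' φ)
    (fun W => overlap ψ φ * coincidence W ψ φ)]
  simp_rw [integral_const_mul, integral_coincidence, Finset.prod_const, Finset.card_univ,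
    Fintype.card_fin]

@[fun_prop]
lemma continuous_unnormalizedFidelity {n : ℕ} {T : Type*} [TopologicalSpace T]
    {U : T → Fin (n + 1) → UnitaryMat d} {ψ : T → PureState d} (hU : Continuous U)
    (hψ : Continuous ψ) (x : Fin n → Fin d) :
    Continuous fun t => unnormalizedFidelity (U t) x (ψ t) := by
  have h : Continuous fun t : (Fin (n + 1) → UnitaryMat d) × PureState d =>
      unnormalizedFidelity t.1 x t.2 := by
    unfold unnormalizedFidelity
    refine continuous_integral_haarPure ?_
    unfold Function.uncurry
    fun_prop
  exact Continuous.comp (f := fun t => (U t, ψ t)) h (hU.prodMk hψ)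

lemma integral_unnormalizedFidelity {n : ℕ} (x : Fin n → Fin d) (ψ : PureState d) :
    ∫ U, unnormalizedFidelity U x ψ ∂haarSequence d (n + 1) =
      (1 / d : ℝ) ^ n * ((d + 3) / (d * (d + 1) ^ 2)) := by
  unfold unnormalizedFidelity
  rw [integral_haarSequence_swap (by unfold Function.uncurry; fun_prop)]
  simp_rw [integral_likelihood_mul_coincidence, integral_const_mul, integral_overlap_mul_one_add]

/-- Here φ' produces the earlier outcomes and φ is the posterior variable. Summing over outcomes
factorizes over the measurements. -/
lemma sum_likelihood_mul_unnormalizedFidelity {n : ℕ} (U : Fin (n + 1) → UnitaryMat d)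
    (φ' ψ : PureState d) :
    ∑ x : Fin n → Fin d, likelihood (Fin.init U : Fin n → UnitaryMat d) x φ' *
      unnormalizedFidelity U x ψ =
      ∫ φ, (∏ i, coincidence ((Fin.init U : Fin n → UnitaryMat d) i) φ' φ) *
        (overlap ψ φ * coincidence (U (Fin.last n)) ψ φ) ∂haarPure d := by
  simp only [unnormalizedFidelity, ← integral_const_mul]
  rw [← integral_finsetSum _ fun x _ => integrable_of_continuous (by fun_prop)]
  refine integral_congr_ae (ae_of_all _ fun φ => ?_)
  simp only [← sum_likelihood_mul_likelihood, Finset.sum_mul]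
  exact Finset.sum_congr rfl fun x _ => by ring

lemma integral_sum_likelihood_mul_unnormalizedFidelity (n : ℕ) (φ' ψ : PureState d) :
    ∫ U, ∑ x : Fin n → Fin d, likelihood (Fin.init U : Fin n → UnitaryMat d) x φ' *
      unnormalizedFidelity U x ψ ∂haarSequence d (n + 1) =
      ∫ φ, ((1 + overlap φ' φ) / (d + 1)) ^ n *
        (overlap ψ φ * ((1 + overlap ψ φ) / (d + 1))) ∂haarPure d := by
  simp_rw [sum_likelihood_mul_unnormalizedFidelity]
  rw [integral_haarSequence_swap (by unfold Function.uncurry; fun_prop)]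
  simp_rw [integral_prod_coincidence]

lemma continuous_sum_likelihood_mul_unnormalizedFidelity {n : ℕ} {T : Type*} [TopologicalSpace T]
    {U : T → Fin (n + 1) → UnitaryMat d} {φ ψ : T → PureState d} (hU : Continuous U)
    (hφ : Continuous φ) (hψ : Continuous ψ) :
    Continuous fun t => ∑ x : Fin n → Fin d,
      likelihood (Fin.init (U t) : Fin n → UnitaryMat d) x (φ t) *
        unnormalizedFidelity (U t) x (ψ t) := by
  fun_prop

lemma le_integral_sampled (n : ℕ) (ψ : PureState d) :
    (1 / d : ℝ) ^ n * ((d + 3) / (d * (d + 1) ^ 2)) ≤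
      ∫ U, ∫ φ, ∑ x : Fin n → Fin d, likelihood (Fin.init U : Fin n → UnitaryMat d) x φ *
        unnormalizedFidelity U x ψ ∂haarPure d ∂haarSequence d (n + 1) := by
  rw [integral_haarSequence_swap (continuous_sum_likelihood_mul_unnormalizedFidelity
    continuous_fst continuous_snd continuous_const)]
  simp_rw [integral_sum_likelihood_mul_unnormalizedFidelity]
  -- The state producing the outcomes becomes the inner variable; the factor depending on ψ then
  -- comes out, and the Bernoulli term averages to zero for each fixed φ.
  rw [integral_integral_swap (integrable_of_continuous (by unfold Function.uncurry; fun_prop)),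
    ← integral_overlap_mul_one_add ψ, ← integral_const_mul]
  refine integral_mono (integrable_of_continuous (by fun_prop)) (integrable_of_continuous ?_)
    fun φ => ?_
  · refine continuous_integral_haarPure ?_
    unfold Function.uncurry
    fun_prop
  · beta_reduce
    rw [integral_mul_const]
    refine mul_le_mul_of_nonneg_right ?_ ?_
    · rw [← integral_bernoulli_overlap φ ((1 / d : ℝ) ^ n) ((1 / d : ℝ) ^ n * n)]
      refine integral_mono (integrable_of_continuous (by fun_prop))
        (integrable_of_continuous (by fun_prop)) fun φ' => ?_
      refine le_trans (le_of_eq ?_) (bernoulli_overlap n (overlap_nonneg φ' φ))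
      rw [overlap_comm φ' φ]
      ring
    · have := overlap_nonneg ψ φ
      positivity

/-- The outcomes now come from ψ itself, so the Bernoulli term multiplies a function of the same
overlap. A Chebyshev-type correlation inequality replaces independence. -/
lemma le_integral_average (n : ℕ) :
    (1 / d : ℝ) ^ n * ((d + 3) / (d * (d + 1) ^ 2)) ≤
      ∫ U, ∫ ψ, ∑ x : Fin n → Fin d, likelihood (Fin.init U : Fin n → UnitaryMat d) x ψ *
        unnormalizedFidelity U x ψ ∂haarPure d ∂haarSequence d (n + 1) := by
  have hd : (0 : ℝ) < d := Nat.cast_pos.mpr (NeZero.pos d)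
  rw [integral_haarSequence_swap (continuous_sum_likelihood_mul_unnormalizedFidelity
    continuous_fst continuous_snd continuous_snd)]
  simp_rw [integral_sum_likelihood_mul_unnormalizedFidelity]
  have hc : ∀ c : ℝ, ∫ _ : PureState d, c ∂haarPure d = c := fun c => by simp
  rw [← hc ((1 / d : ℝ) ^ n * ((d + 3) / (d * (d + 1) ^ 2)))]
  refine integral_mono (integrable_of_continuous (by fun_prop)) (integrable_of_continuous ?_)
    fun ψ => ?_
  · refine continuous_integral_haarPure ?_
    unfold Function.uncurry
    fun_prop
  beta_reduce
  have h2 : ∫ φ, (1 / d : ℝ) ^ n * (overlap ψ φ * ((1 + overlap ψ φ) / (d + 1)) +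
      n * (1 / d ^ 2) * ((d * overlap ψ φ - 1) / (d + 1))) ∂haarPure d =
      (1 / d : ℝ) ^ n * ((d + 3) / (d * (d + 1) ^ 2)) := by
    have h3 := integral_bernoulli_overlap ψ 0 (n * (1 / d ^ 2))
    simp only [zero_add] at h3
    rw [integral_const_mul, integral_add (integrable_of_continuous (by fun_prop))
      (integrable_of_continuous (by fun_prop)), integral_overlap_mul_one_add, h3, add_zero]
  rw [← h2]
  refine integral_mono (integrable_of_continuous (by fun_prop))
    (integrable_of_continuous (by fun_prop)) fun φ => ?_
  have hq := overlap_nonneg ψ φ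
  beta_reduce
  generalize overlap ψ φ = q at hq
  have hk : 0 ≤ q * ((1 + q) / (d + 1)) := by positivity
  refine le_trans ?_ (mul_le_mul_of_nonneg_right (bernoulli_overlap (d := d) n hq) hk)
  rw [mul_assoc ((1 / d : ℝ) ^ n)]
  refine mul_le_mul_of_nonneg_left ?_ (by positivity)
  -- The value of q(1 + q)/(d + 1) at q = 1/d is 1/d². Both factors increase for q ≥ 0 and vanish at
  -- 1/d, so they have the same sign.
  have hcheb : (0 : ℝ) ≤ (q * ((1 + q) / (d + 1)) - 1 / d ^ 2) * ((d * q - 1) / (d + 1)) := by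
    have : (q * ((1 + q) / (d + 1)) - 1 / d ^ 2) * ((d * q - 1) / (d + 1)) =
        (d * q - 1) ^ 2 * (d * q + d + 1) / (d ^ 2 * (d + 1) ^ 2) := by
      field_simp
      ring
    rw [this]
    positivity
  have hn : (0 : ℝ) ≤ n := n.cast_nonneg
  have := mul_nonneg hn hcheb
  linarith

/-! ### The averaged risk -/

lemma f_succ_eq (d n : ℕ) [NeZero d] : f d (n + 1) =
    (maxTotalProb d (n + 1))⁻¹ * ((1 / d : ℝ) ^ n * ((d + 3) / (d * (d + 1) ^ 2))) := by
  have hd : (d : ℝ) ≠ 0 := NeZero.ne _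
  unfold f maxTotalProb
  rw [inv_div, one_div, inv_pow, pow_succ]
  field_simp

/-- The common last step for all three senses of the risk, which differ only in the linear minorant
g and in the bound on its integral. -/
lemma integrable_and_integral_le {n : ℕ} {X g : (Fin (n + 1) → UnitaryMat d) → ℝ}
    (hX : Measurable X) (h0 : ∀ U, 0 ≤ X U) (h1 : ∀ U, X U ≤ 1) (hg : Continuous g)
    (hXg : ∀ U, X U ≤ 1 - (maxTotalProb d (n + 1))⁻¹ * g U)
    (hint : (1 / d : ℝ) ^ n * ((d + 3) / (d * (d + 1) ^ 2)) ≤ ∫ U, g U ∂haarSequence d (n + 1)) :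
    Integrable X (haarSequence d (n + 1)) ∧
      ∫ U, X U ∂haarSequence d (n + 1) ≤ 1 - f d (n + 1) := by
  have hi : Integrable X (haarSequence d (n + 1)) :=
    Integrable.of_bound hX.aestronglyMeasurable 1 (ae_of_all _ fun U => by
      rw [Real.norm_of_nonneg (h0 U)]; exact h1 U)
  refine ⟨hi, ?_⟩
  have hig : Integrable g (haarSequence d (n + 1)) := integrable_of_continuous hg
  refine (integral_mono hi ((integrable_const 1).sub (hig.const_mul _)) hXg).trans ?_
  simp only [Pi.sub_apply]
  rw [integral_sub (integrable_const 1) (hig.const_mul _), integral_const_mul, f_succ_eq]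
  have := mul_le_mul_of_nonneg_left hint (inv_nonneg.mpr (maxTotalProb_pos d (n + 1)).le)
  simpa using sub_le_sub_left this 1

lemma integral_risk_le {n : ℕ} (ψ : PureState d) (x : Fin n → Fin d) :
    Integrable (fun U => risk U x ψ) (haarSequence d (n + 1)) ∧
      ∫ U, risk U x ψ ∂haarSequence d (n + 1) ≤ 1 - f d (n + 1) :=
  integrable_and_integral_le
    (Measurable.of_uncurry_right (f := fun U ψ => risk U x ψ) (measurable_risk x))
    (fun U => risk_nonneg U x ψ) (fun U => risk_le_one U x ψ)
    (continuous_unnormalizedFidelity continuous_id continuous_const x)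
    (fun U => risk_le U x ψ) (integral_unnormalizedFidelity x ψ).ge

lemma integral_sampledRisk_le {n : ℕ} (ψ : PureState d) :
    Integrable (fun U : Fin (n + 1) → UnitaryMat d => sampledRisk U ψ) (haarSequence d (n + 1)) ∧
      ∫ U, sampledRisk U ψ ∂haarSequence d (n + 1) ≤ 1 - f d (n + 1) := by
  refine integrable_and_integral_le ?_ (fun U => ?_) (fun U => ?_) ?_ (fun U => ?_)
    (le_integral_sampled n ψ)
  · refine Finset.measurable_sum _ fun x _ => Measurable.mul ?_
      (Measurable.of_uncurry_right (f := fun U ψ => risk U x ψ) (measurable_risk x))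
    exact ((continuous_totalProb x).comp continuous_init).measurable
  · exact Finset.sum_nonneg fun x _ => mul_nonneg (totalProb_nonneg _ _) (risk_nonneg _ _ _)
  · rw [← sum_totalProb (Fin.init U : Fin n → UnitaryMat d)]
    exact Finset.sum_le_sum fun x _ =>
      mul_le_of_le_one_right (totalProb_nonneg _ _) (risk_le_one _ _ _)
  · exact continuous_integral_haarPure (continuous_sum_likelihood_mul_unnormalizedFidelity
      continuous_fst continuous_snd continuous_const)
  · rw [integral_finsetSum _ fun x _ => integrable_of_continuous (by fun_prop)]
    simp_rw [integral_mul_const]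
    refine le_of_le_of_eq ?_ (congrArg (fun t : ℝ => t - _)
      (sum_totalProb (Fin.init U : Fin n → UnitaryMat d)))
    rw [Finset.mul_sum, ← Finset.sum_sub_distrib]
    refine Finset.sum_le_sum fun x _ => ?_
    have := mul_le_mul_of_nonneg_left (risk_le U x ψ)
      (totalProb_nonneg (Fin.init U : Fin n → UnitaryMat d) x)
    refine this.trans (le_of_eq ?_)
    rw [totalProb]
    ring

lemma integral_averageRisk_le {n : ℕ} :
    Integrable (fun U : Fin (n + 1) → UnitaryMat d => averageRisk U) (haarSequence d (n + 1)) ∧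
      ∫ U, averageRisk U ∂haarSequence d (n + 1) ≤ 1 - f d (n + 1) := by
  refine integrable_and_integral_le ?_ (fun U => ?_) (fun U => ?_) ?_ (fun U => ?_)
    (le_integral_average n)
  · simp only [averageRisk_eq]
    refine Finset.measurable_sum _ fun x _ => ?_
    have hm : Measurable fun t : (Fin (n + 1) → UnitaryMat d) × PureState d =>
        likelihood (Fin.init t.1 : Fin n → UnitaryMat d) x t.2 * risk t.1 x t.2 :=
      Measurable.mul (Continuous.measurable (by fun_prop)) (measurable_risk x)
    exact hm.stronglyMeasurable.integral_prod_right'.measurable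
  · rw [averageRisk_eq]
    exact Finset.sum_nonneg fun x _ => integral_likelihood_mul_risk_nonneg U x
  · rw [averageRisk_eq]
    exact (Finset.sum_le_sum fun x _ => integral_likelihood_mul_risk_le_totalProb U x).trans_eq
      (sum_totalProb (Fin.init U : Fin n → UnitaryMat d))
  · exact continuous_integral_haarPure (continuous_sum_likelihood_mul_unnormalizedFidelity
      continuous_fst continuous_snd continuous_snd)
  · have hc : ∀ x : Fin n → Fin d, Continuous fun ψ =>
        likelihood (Fin.init U : Fin n → UnitaryMat d) x ψ * unnormalizedFidelity U x ψ :=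
      fun x => by fun_prop
    rw [averageRisk_eq, integral_finsetSum _ fun x _ => integrable_of_continuous (hc x)]
    refine le_of_le_of_eq ?_ (congrArg (fun t : ℝ => t - _)
      (sum_totalProb (Fin.init U : Fin n → UnitaryMat d)))
    rw [Finset.mul_sum, ← Finset.sum_sub_distrib]
    refine Finset.sum_le_sum fun x _ => ?_
    have hi : Integrable (fun ψ => likelihood (Fin.init U : Fin n → UnitaryMat d) x ψ)
        (haarPure d) := integrable_of_continuous (by fun_prop)
    have hi2 := (integrable_of_continuous (μ := haarPure d) (hc x)).const_mul
      (maxTotalProb d (n + 1))⁻¹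
    rw [totalProb, ← integral_const_mul, ← integral_sub hi hi2]
    refine integral_mono (integrable_likelihood_mul_risk U x) (hi.sub hi2) fun ψ => ?_
    have := mul_le_mul_of_nonneg_left (risk_le U x ψ)
      (likelihood_nonneg (Fin.init U : Fin n → UnitaryMat d) x ψ)
    refine this.trans (le_of_eq ?_)
    ring

end HaarBayes

theorem lemma1 (d n : ℕ) [NeZero d] :
    (∀ (ψ : HaarBayes.PureState d) (x : Fin n → Fin d),
      Integrable (fun U => HaarBayes.risk U x ψ) (HaarBayes.haarSequence d (n + 1)) ∧
      ∫ U, HaarBayes.risk U x ψ ∂HaarBayes.haarSequence d (n + 1) ≤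
        1 - HaarBayes.f d (n + 1)) ∧
    (∀ ψ : HaarBayes.PureState d,
      Integrable (fun U => HaarBayes.sampledRisk U ψ) (HaarBayes.haarSequence d (n + 1)) ∧
      ∫ U, HaarBayes.sampledRisk U ψ ∂HaarBayes.haarSequence d (n + 1) ≤
        1 - HaarBayes.f d (n + 1)) ∧
    (Integrable (fun U => HaarBayes.averageRisk U) (HaarBayes.haarSequence d (n + 1)) ∧
      ∫ U, HaarBayes.averageRisk U ∂HaarBayes.haarSequence d (n + 1) ≤
        1 - HaarBayes.f d (n + 1)) :=
  ⟨fun ψ x => HaarBayes.integral_risk_le ψ x, fun ψ => HaarBayes.integral_sampledRisk_le ψ,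
    HaarBayes.integral_averageRisk_le⟩
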